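/- Let $\mathbb{R}_+=(0,\infty)$. For $p\in(1,\infty)$, a measurable function $w:\mathbb{R}\to[0,\infty)$, positive almost everywhere, belongs to the Muckenhoupt class $A_p$ if $$[w]_{A_p}:=\sup_{a<b}\Big(\frac1{b-a}\int_a^b w\,dt\Big)\Big(\frac1{b-a}\int_a^b w^{-\frac1{p-1}}\,dt\Big)^{p-1}<\infty .$$ Let $X_0,X_1$ be Banach spaces that are continuously embedded in one Hausdorff topological vector space $Z$, and let $X_0+X_1\subset Z$ be their sum. For $a\in X_0+X_1$ and $t>0$ put $$K(t,a):=\inf\{\|a_0\|_{X_0}+t\|a_1\|_{X_1}: a=a_0+a_1,\ a_0\in X_0,\ a_1\in X_1\},$$ and for $\phi:\mathbb{R}_+\to\mathbb{R}_+$ put $$\|a\|_{(X_0,X_1)_{\phi,p}}:=\Big(\int_0^\infty\big(\phi(t^{-1})K(t,a)\big)^p\,\frac{dt}{t}\Big)^{1/p},\qquad (X_0,X_1)_{\phi,p}:=\{a\in X_0+X_1:\|a\|_{(X_0,X_1)_{\phi,p}}<\infty\}.$$ For a Banach space $X$, $L_p(\mathbb{R}_+,w\,dt;X)$ consists of the strongly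 measurable $g:\mathbb{R}_+\to X$ with $\|g\|_{L_p(\mathbb{R}_+,w\,dt;X)}:=\big(\int_0^\infty\|g(t)\|_X^p\,w(t)\,dt\big)^{1/p}<\infty$. **Theorem 1.1.** There is a function $C(\cdot,\cdot)$ with finite nonnegative values such that the following holds. Let $p\in(1,\infty)$, $w\in A_p$ and $W(t):=\int_0^t w(s)\,ds$, and let $X_0,X_1,Z$ be as above. Suppose that $u\in L_p(\mathbb{R}_+,w\,dt;X_0)$, $f\in L_p(\mathbb{R}_+,w\,dt;X_1)$, $u_0\in X_0+X_1$, and $$u(t)=u_0+\int_0^t f(s)\,ds\qquad\text{for almost every } t\in\mathbb{R}_+ ,$$ as an identity in $X_0+X_1$, where the integral is a Bochner integral in $X_1$. Then $u_0\in(X_0,X_1)_{W^{1/p},p}$ and $$\|u_0\|_{(X_0,X_1)_{W^{1/p},p}}\le C\big(p,[w]_{A_p}\big)\Big(\|u\|_{L_p(\mathbb{R}_+,w\,dt;X_0)}+\|f\|_{L_p(\mathbb{R}_+,w\,dt;X_1)}\Big).$$ -/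

import Mathlib

open MeasureTheory Set
open scoped ENNReal NNReal

noncomputable section

namespace WeightedTrace

/-- The Muckenhoupt characteristic `[w]_{A_p}` of `w : ℝ → [0, ∞)`: the supremum over all compact
intervals `[a, b]` with `a < b` of
`(⨍_a^b w) * (⨍_a^b w ^ (-1/(p-1))) ^ (p-1)`, with value in `[0, ∞]` (and `0 ^ (-1/(p-1)) = ∞`). -/
def apConst (p : ℝ) (w : ℝ → ℝ≥0) : ℝ≥0∞ :=
  ⨆ (a : ℝ) (b : ℝ) (_ : a < b),
    ((∫⁻ t in Icc a b, (w t : ℝ≥0∞)) / ENNReal.ofReal (b - a)) *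
      ((∫⁻ t in Icc a b, (w t : ℝ≥0∞) ^ (-(1 / (p - 1)))) / ENNReal.ofReal (b - a)) ^ (p - 1)

/-- `w ∈ A_p(ℝ)`. As for every weight, `w` is positive almost everywhere; this only excludes
`w = 0` a.e., for which the product `0 * ∞` in the characteristic has no meaning. -/
structure IsMuckenhoupt (p : ℝ) (w : ℝ → ℝ≥0) : Prop where
  measurable : Measurable w
  ae_pos : ∀ᵐ t : ℝ, 0 < w t
  apConst_lt_top : apConst p w < ∞

/-- `W(t) = ∫_0^t w(s) ds` for `t > 0`. -/
def primitive (w : ℝ → ℝ≥0) (t : ℝ) : ℝ≥0∞ :=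
  ∫⁻ s in Ioc 0 t, (w s : ℝ≥0∞)

/-- The measure `w dt` on `ℝ₊ = (0, ∞)`. -/
def halfLineMeasure (w : ℝ → ℝ≥0) : Measure ℝ :=
  (volume.restrict (Ioi 0)).withDensity fun t => (w t : ℝ≥0∞)

/-- An interpolation couple: `X₀` and `X₁` are continuously embedded in the same topological
vector space `Z`. (Completeness of `X₀`, `X₁` and the Hausdorff property of `Z` are required
where couples are used.) -/
structure InterpolationCouple (X₀ X₁ Z : Type*)
    [NormedAddCommGroup X₀] [NormedSpace ℝ X₀] [NormedAddCommGroup X₁] [NormedSpace ℝ X₁]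
    [AddCommGroup Z] [Module ℝ Z] [TopologicalSpace Z] where
  ι₀ : X₀ →L[ℝ] Z
  ι₁ : X₁ →L[ℝ] Z
  injective₀ : Function.Injective ι₀
  injective₁ : Function.Injective ι₁

namespace InterpolationCouple

variable {X₀ X₁ Z : Type*}
  [NormedAddCommGroup X₀] [NormedSpace ℝ X₀] [NormedAddCommGroup X₁] [NormedSpace ℝ X₁]
  [AddCommGroup Z] [Module ℝ Z] [TopologicalSpace Z]

/-- The sum `X₀ + X₁`, as a subset of `Z`. -/
def sum (E : InterpolationCouple X₀ X₁ Z) : Set Z :=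
  {a | ∃ (x₀ : X₀) (x₁ : X₁), a = E.ι₀ x₀ + E.ι₁ x₁}

/-- The `K`-functional
`K(t, a; X₀, X₁) = inf {‖a₀‖ + t ‖a₁‖ : a = a₀ + a₁, a₀ ∈ X₀, a₁ ∈ X₁}` (it is `∞` off
`X₀ + X₁`). -/
def K (E : InterpolationCouple X₀ X₁ Z) (t : ℝ) (a : Z) : ℝ≥0∞ :=
  ⨅ (x₀ : X₀) (x₁ : X₁) (_ : a = E.ι₀ x₀ + E.ι₁ x₁), ENNReal.ofReal (‖x₀‖ + t * ‖x₁‖)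

/-- The norm of the generalized real interpolation space `(X₀, X₁)_{φ,p}`, `1 ≤ p < ∞`:
`(∫_0^∞ (φ(1/t) K(t, a; X₀, X₁)) ^ p dt/t) ^ (1/p)`, with value in `[0, ∞]`. -/
def interpNorm (E : InterpolationCouple X₀ X₁ Z) (φ : ℝ → ℝ≥0∞) (p : ℝ) (a : Z) : ℝ≥0∞ :=
  (∫⁻ t in Ioi (0 : ℝ), (φ t⁻¹ * E.K t a) ^ p / ENNReal.ofReal t) ^ (1 / p)

/-- The generalized real interpolation space `(X₀, X₁)_{φ,p}`. -/
def interpSpace (E : InterpolationCouple X₀ X₁ Z) (φ : ℝ → ℝ≥0∞) (p : ℝ) : Set Z :=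
  {a | a ∈ E.sum ∧ E.interpNorm φ p a < ∞}

end InterpolationCouple

end WeightedTrace

end

/-! For τ ≤ 1/t the splitting u₀ = u(τ) - ∫_0^τ f, averaged over τ ∈ (0, 1/t], bounds K(t, u₀) by t
∫_0^{1/t} (‖u‖ + ‖f‖) (`K_le_average`). What remains is a Hardy inequality in L_p(w)
(`rpow_lintegral_hardy_le`).

For it, put s = 1/t, let σ be the dual weight, and cut (0, s] into dyadic pieces. Hölder bounds the
integral over each piece by its L_p(w) norm times a power of its σ-mass. The A_p condition forces a
fixed proportion of the σ-mass of (0, s] into (s/2, s], so these masses decay geometrically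
(`dualPrimitive_mul_pow_le`). A_p on (0, s] absorbs the factor W(s), Jensen moves the p-th power
inside the geometric series, and Tonelli integrates each dyadic term in dt/t
(`lintegral_lintegral_Ioc_inv_mul_pow_le`). -/

noncomputable section

namespace WeightedTrace

/-! ### The dual weight and the constants -/

/-- The dual weight `w ^ (-1/(p-1))`. -/
def dualWeight (p : ℝ) (w : ℝ → ℝ≥0) (t : ℝ) : ℝ≥0∞ :=
  (w t : ℝ≥0∞) ^ (-(1 / (p - 1)))

/-- The primitive of the dual weight that vanishes at `0`. -/
def dualPrimitive (p : ℝ) (w : ℝ → ℝ≥0) (t : ℝ) : ℝ≥0∞ :=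
  ∫⁻ s in Ioc 0 t, dualWeight p w s

/-- The constant in the bound of the primitive of the dual weight on `(0, s]` by its integral over
`(s/2, s]`. -/
def halvingConst (p : ℝ) (A : ℝ≥0∞) : ℝ≥0∞ :=
  (A * 2 ^ p) ^ (1 / (p - 1))

/-- The geometric rate at which the primitive of the dual weight decreases under halving. -/
def halvingRate (p : ℝ) (A : ℝ≥0∞) : ℝ≥0∞ :=
  1 - (halvingConst p A)⁻¹

/-- The operator norm bound in the weighted Hardy inequality. -/
def hardyConst (p : ℝ) (A : ℝ≥0∞) : ℝ≥0∞ :=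
  A ^ (1 / p) * (1 - halvingRate p A ^ ((p - 1) / p))⁻¹

variable {p : ℝ} {w : ℝ → ℝ≥0}

lemma halvingConst_lt_top (hp : 1 < p) {A : ℝ≥0∞} (hA : A < ∞) : halvingConst p A < ∞ := by
  refine ENNReal.rpow_lt_top_of_nonneg (by positivity) (ENNReal.mul_ne_top hA.ne ?_)
  exact ENNReal.rpow_ne_top_of_nonneg (by linarith) (by simp)

lemma halvingRate_lt_one (hp : 1 < p) {A : ℝ≥0∞} (hA : A < ∞) : halvingRate p A < 1 :=
  ENNReal.sub_lt_self (by simp) (by simp)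
    (ENNReal.inv_ne_zero.2 (halvingConst_lt_top hp hA).ne)

lemma halvingRate_rpow_lt_one (hp : 1 < p) {A : ℝ≥0∞} (hA : A < ∞) :
    halvingRate p A ^ ((p - 1) / p) < 1 :=
  ENNReal.rpow_lt_one (halvingRate_lt_one hp hA) (div_pos (by linarith) (by linarith))

lemma hardyConst_lt_top (hp : 1 < p) {A : ℝ≥0∞} (hA : A < ∞) : hardyConst p A < ∞ := by
  have h := halvingRate_rpow_lt_one hp hA
  refine ENNReal.mul_lt_top (ENNReal.rpow_lt_top_of_nonneg (by positivity) hA.ne) ?_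
  exact ENNReal.inv_lt_top.2 (tsub_pos_of_lt h)

lemma measurable_dualWeight (hw : Measurable w) : Measurable (dualWeight p w) :=
  hw.coe_nnreal_ennreal.pow_const _

/-! ### Consequences of the A_p condition on (0, s] -/

/-- Hölder's inequality for a weight and its dual. -/
lemma lintegral_le_rpow_mul_dualWeight (hp : 1 < p) (hw : IsMuckenhoupt p w) {g : ℝ → ℝ≥0∞}
    (hg : Measurable g) (E : Set ℝ) :
    ∫⁻ t in E, g t ≤ (∫⁻ t in E, g t ^ p * w t) ^ (1 / p) *
      (∫⁻ t in E, dualWeight p w t) ^ ((p - 1) / p) := by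
  have hp0 : 0 < p := by linarith
  have hpq : p.HolderConjugate (p / (p - 1)) := Real.HolderConjugate.conjExponent hp
  have hwm : Measurable fun t => (w t : ℝ≥0∞) := hw.measurable.coe_nnreal_ennreal
  have key := ENNReal.lintegral_mul_le_Lp_mul_Lq (volume.restrict E) hpq
    (f := fun t => g t * (w t : ℝ≥0∞) ^ (1 / p)) (g := fun t => (w t : ℝ≥0∞) ^ (-(1 / p)))
    (hg.mul (hwm.pow_const _)).aemeasurable (hwm.pow_const _).aemeasurable
  calc ∫⁻ t in E, g t = ∫⁻ t in E, ((fun t => g t * (w t : ℝ≥0∞) ^ (1 / p)) *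
        fun t => (w t : ℝ≥0∞) ^ (-(1 / p))) t := by
        refine lintegral_congr_ae ?_
        -- Cancelling w^(1/p) against w^(-1/p) requires w ≠ 0.
        filter_upwards [ae_restrict_of_ae hw.ae_pos] with t ht
        have h0 : (w t : ℝ≥0∞) ≠ 0 := by simpa using ht.ne'
        simp only [Pi.mul_apply]
        rw [mul_assoc, ← ENNReal.rpow_add _ _ h0 ENNReal.coe_ne_top]
        simp
    _ ≤ _ := key
    _ = _ := by
        congr 1
        · congr 1
          refine lintegral_congr fun t => ?_
          rw [ENNReal.mul_rpow_of_nonneg _ _ hp0.le, ← ENNReal.rpow_mul]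
          simp [hp0.ne']
        · rw [one_div_div]
          congr 1
          refine lintegral_congr fun t => ?_
          rw [← ENNReal.rpow_mul, dualWeight]
          congr 1
          field_simp

lemma primitive_mul_dualPrimitive_le (w : ℝ → ℝ≥0) {s : ℝ} (hp : 1 < p) (hs : 0 < s) :
    primitive w s * dualPrimitive p w s ^ (p - 1) ≤ apConst p w * ENNReal.ofReal s ^ p := by
  have hp1 : 0 < p - 1 := by linarith
  have h0 : ENNReal.ofReal s ≠ 0 := by simpa using hs
  have h : (primitive w s / ENNReal.ofReal s) *
      (dualPrimitive p w s / ENNReal.ofReal s) ^ (p - 1) ≤ apConst p w := by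
    have := le_iSup_of_le (f := fun a : ℝ => ⨆ (b : ℝ) (_ : a < b),
      ((∫⁻ t in Icc a b, (w t : ℝ≥0∞)) / ENNReal.ofReal (b - a)) *
      ((∫⁻ t in Icc a b, (w t : ℝ≥0∞) ^ (-(1 / (p - 1)))) / ENNReal.ofReal (b - a)) ^ (p - 1))
      0 (le_iSup₂_of_le s hs le_rfl)
    simpa only [sub_zero, apConst, primitive, dualPrimitive, dualWeight, restrict_Ioc_eq_restrict_Icc]
      using this
  rw [ENNReal.div_rpow_of_nonneg _ _ hp1.le] at h
  have hsp : ENNReal.ofReal s ^ p = ENNReal.ofReal s * ENNReal.ofReal s ^ (p - 1) := by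
    conv_rhs => enter [1]; rw [← ENNReal.rpow_one (ENNReal.ofReal s)]
    rw [← ENNReal.rpow_add_of_nonneg _ _ zero_le_one hp1.le, add_sub_cancel]
  calc primitive w s * dualPrimitive p w s ^ (p - 1)
      = (primitive w s / ENNReal.ofReal s * ENNReal.ofReal s) *
        (dualPrimitive p w s ^ (p - 1) / ENNReal.ofReal s ^ (p - 1) *
          ENNReal.ofReal s ^ (p - 1)) := by
        rw [ENNReal.div_mul_cancel h0 ENNReal.ofReal_ne_top, ENNReal.div_mul_cancel]
        · exact (ENNReal.rpow_pos (pos_iff_ne_zero.2 h0) ENNReal.ofReal_ne_top).ne'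
        · exact ENNReal.rpow_ne_top_of_nonneg hp1.le ENNReal.ofReal_ne_top
    _ = (primitive w s / ENNReal.ofReal s *
        (dualPrimitive p w s ^ (p - 1) / ENNReal.ofReal s ^ (p - 1))) * ENNReal.ofReal s ^ p := by
        rw [hsp]; ring
    _ ≤ _ := by gcongr

lemma primitive_pos (hw : IsMuckenhoupt p w) {s : ℝ} (hs : 0 < s) : 0 < primitive w s := by
  rw [primitive, lintegral_pos_iff_support hw.measurable.coe_nnreal_ennreal,
    Measure.restrict_apply' measurableSet_Ioc]
  have : volume (Function.support (fun t => (w t : ℝ≥0∞)) ∩ Ioc 0 s) = volume (Ioc 0 s) := by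
    refine measure_congr ?_
    filter_upwards [hw.ae_pos] with t ht
    have h : t ∈ Function.support (fun t => (w t : ℝ≥0∞)) := by simpa using ht.ne'
    exact propext ⟨fun H => H.2, fun H => ⟨h, H⟩⟩
  rw [this]
  simpa using hs

lemma dualPrimitive_pos (hp : 1 < p) (hw : IsMuckenhoupt p w) {s : ℝ} (hs : 0 < s) :
    0 < dualPrimitive p w s := by
  have hp1 : 0 < p - 1 := by linarith
  rw [dualPrimitive, lintegral_pos_iff_support (measurable_dualWeight hw.measurable)]
  have : Function.support (dualWeight p w) = univ := by
    ext t
    simp [dualWeight, ENNReal.rpow_eq_zero_iff, hp.le]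
  rw [this]
  simpa using hs

/-- Local integrability is not assumed: it follows from A_p, since an infinite factor times a
positive one would exceed a finite bound. -/
lemma primitive_lt_top (hp : 1 < p) (hw : IsMuckenhoupt p w) {s : ℝ} (hs : 0 < s) :
    primitive w s < ∞ := by
  refine lt_top_iff_ne_top.2 fun h => ?_
  have h1 := primitive_mul_dualPrimitive_le w hp hs
  have h2 : dualPrimitive p w s ^ (p - 1) ≠ 0 := by
    simp [ENNReal.rpow_eq_zero_iff, (dualPrimitive_pos hp hw hs).ne', hp.le]
  rw [h, ENNReal.top_mul h2, top_le_iff] at h1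
  exact ENNReal.mul_ne_top hw.apConst_lt_top.ne
    (ENNReal.rpow_ne_top_of_nonneg (by linarith) ENNReal.ofReal_ne_top) h1

lemma dualPrimitive_lt_top (hp : 1 < p) (hw : IsMuckenhoupt p w) {s : ℝ} (hs : 0 < s) :
    dualPrimitive p w s < ∞ := by
  have hp1 : 0 < p - 1 := by linarith
  refine lt_top_iff_ne_top.2 fun h => ?_
  have h1 := primitive_mul_dualPrimitive_le w hp hs
  rw [h, ENNReal.top_rpow_of_pos hp1, ENNReal.mul_top (primitive_pos hw hs).ne',
    top_le_iff] at h1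
  exact ENNReal.mul_ne_top hw.apConst_lt_top.ne
    (ENNReal.rpow_ne_top_of_nonneg (by linarith) ENNReal.ofReal_ne_top) h1

/-- Hölder with g = 1 on (s/2, s] bounds s^p above by W(s) times a power of the dual mass there.
Inserted into the A_p bound on (0, s], this leaves W(s) on both sides, where it cancels, being
positive and finite. -/
lemma dualPrimitive_le_halvingConst_mul (hp : 1 < p) (hw : IsMuckenhoupt p w) {s : ℝ}
    (hs : 0 < s) :
    dualPrimitive p w s ≤
      halvingConst p (apConst p w) * ∫⁻ t in Ioc (s * 2⁻¹) s, dualWeight p w t := by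
  have hp0 : 0 < p := by linarith
  have hp1 : 0 < p - 1 := by linarith
  set D := ∫⁻ t in Ioc (s * 2⁻¹) s, dualWeight p w t
  have h1 : ENNReal.ofReal s ≤ 2 * (primitive w s ^ (1 / p) * D ^ ((p - 1) / p)) := by
    have h := lintegral_le_rpow_mul_dualWeight hp hw (g := fun _ => 1) measurable_const
      (Ioc (s * 2⁻¹) s)
    simp only [ENNReal.one_rpow, one_mul, setLIntegral_one, Real.volume_Ioc] at h
    calc ENNReal.ofReal s = 2 * ENNReal.ofReal (s - s * 2⁻¹) := by
          rw [← ENNReal.ofReal_ofNat, ← ENNReal.ofReal_mul (by norm_num)]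
          congr 1; ring
      _ ≤ _ := by
          gcongr
          refine h.trans ?_
          gcongr
          exact lintegral_mono_set (Ioc_subset_Ioc_left (by positivity))
  have h2 : ENNReal.ofReal s ^ p ≤ 2 ^ p * (primitive w s * D ^ (p - 1)) := by
    refine (ENNReal.rpow_le_rpow h1 hp0.le).trans_eq ?_
    rw [ENNReal.mul_rpow_of_nonneg _ _ hp0.le, ENNReal.mul_rpow_of_nonneg _ _ hp0.le,
      ← ENNReal.rpow_mul, ← ENNReal.rpow_mul, one_div_mul_cancel hp0.ne',
      div_mul_cancel₀ _ hp0.ne', ENNReal.rpow_one]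
  have h3 : primitive w s * dualPrimitive p w s ^ (p - 1) ≤
      primitive w s * (apConst p w * 2 ^ p * D ^ (p - 1)) := by
    refine (primitive_mul_dualPrimitive_le w hp hs).trans ?_
    calc _ ≤ apConst p w * (2 ^ p * (primitive w s * D ^ (p - 1))) := by gcongr
      _ = _ := by ring
  rw [ENNReal.mul_le_mul_iff_right (primitive_pos hw hs).ne' (primitive_lt_top hp hw hs).ne] at h3
  have h4 := ENNReal.rpow_le_rpow h3 (z := 1 / (p - 1)) (by positivity)
  rw [ENNReal.mul_rpow_of_nonneg _ _ (by positivity), ← ENNReal.rpow_mul, ← ENNReal.rpow_mul,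
    mul_one_div_cancel hp1.ne', ENNReal.rpow_one, ENNReal.rpow_one] at h4
  exact h4

lemma dualPrimitive_half_le (hp : 1 < p) (hw : IsMuckenhoupt p w) {s : ℝ} (hs : 0 < s) :
    dualPrimitive p w (s * 2⁻¹) ≤ halvingRate p (apConst p w) * dualPrimitive p w s := by
  have hfin := (dualPrimitive_lt_top hp hw hs).ne
  have hsplit : dualPrimitive p w s =
      dualPrimitive p w (s * 2⁻¹) + ∫⁻ t in Ioc (s * 2⁻¹) s, dualWeight p w t := by
    rw [dualPrimitive, dualPrimitive, ← lintegral_union measurableSet_Ioc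
      (Ioc_disjoint_Ioc_of_le le_rfl), Ioc_union_Ioc_eq_Ioc] <;> linarith
  rw [halvingRate, ENNReal.sub_mul fun _ _ => hfin, one_mul]
  have hle : (halvingConst p (apConst p w))⁻¹ * dualPrimitive p w s ≤
      ∫⁻ t in Ioc (s * 2⁻¹) s, dualWeight p w t := by
    rw [mul_comm, ← div_eq_mul_inv]
    exact ENNReal.div_le_of_le_mul' (dualPrimitive_le_halvingConst_mul hp hw hs)
  refine ENNReal.le_sub_of_add_le_right ?_ ?_
  · exact ne_top_of_le_ne_top hfin (hle.trans (hsplit ▸ le_add_self))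
  · calc _ ≤ dualPrimitive p w (s * 2⁻¹) + ∫⁻ t in Ioc (s * 2⁻¹) s, dualWeight p w t := by gcongr
      _ = _ := hsplit.symm

lemma dualPrimitive_mul_pow_le (hp : 1 < p) (hw : IsMuckenhoupt p w) {s : ℝ} (hs : 0 < s)
    (m : ℕ) :
    dualPrimitive p w (s * 2⁻¹ ^ m) ≤ halvingRate p (apConst p w) ^ m * dualPrimitive p w s := by
  induction m with
  | zero => simp
  | succ m ih =>
    calc dualPrimitive p w (s * 2⁻¹ ^ (m + 1))
        = dualPrimitive p w (s * 2⁻¹ ^ m * 2⁻¹) := by rw [pow_succ, mul_assoc]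
      _ ≤ halvingRate p (apConst p w) * dualPrimitive p w (s * 2⁻¹ ^ m) :=
          dualPrimitive_half_le hp hw (by positivity)
      _ ≤ halvingRate p (apConst p w) *
          (halvingRate p (apConst p w) ^ m * dualPrimitive p w s) := by gcongr
      _ = _ := by rw [pow_succ]; ring

/-! ### The weighted Hardy inequality -/

lemma Ioc_subset_iUnion_Ioc_mul_pow {s : ℝ} (hs : 0 < s) :
    Ioc 0 s ⊆ ⋃ m : ℕ, Ioc (s * 2⁻¹ ^ (m + 1)) (s * 2⁻¹ ^ m) := by
  rintro t ⟨ht0, hts⟩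
  obtain ⟨m, h1, h2⟩ := exists_nat_pow_near_of_lt_one (div_pos ht0 hs) ((div_le_one hs).2 hts)
    (y := (2⁻¹ : ℝ)) (by norm_num) (by norm_num)
  rw [lt_div_iff₀ hs] at h1
  rw [div_le_iff₀ hs] at h2
  exact mem_iUnion.2 ⟨m, by linarith, by linarith⟩

/-- Jensen's inequality for a geometric series. -/
lemma tsum_pow_mul_rpow_le (hp : 1 < p) (r : ℝ≥0∞) (y : ℕ → ℝ≥0∞) :
    (∑' m, r ^ m * y m ^ (1 / p)) ^ p ≤ (1 - r)⁻¹ ^ (p - 1) * ∑' m, r ^ m * y m := by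
  have hp0 : 0 < p := by linarith
  have hp1 : 0 < p - 1 := by linarith
  have hpq : p.HolderConjugate (p / (p - 1)) := Real.HolderConjugate.conjExponent hp
  -- Hölder for the counting measure, splitting r^m = (r^m)^(1/p) (r^m)^((p-1)/p).
  have key := ENNReal.lintegral_mul_le_Lp_mul_Lq Measure.count hpq
    (f := fun m => (r ^ m * y m) ^ (1 / p)) (g := fun m => (r ^ m) ^ ((p - 1) / p))
    (measurable_of_countable _).aemeasurable (measurable_of_countable _).aemeasurable
  simp only [lintegral_count, Pi.mul_apply, ← ENNReal.rpow_mul, one_div_div,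
    one_div_mul_cancel hp0.ne', ENNReal.rpow_one] at key
  rw [show (p - 1) / p * (p / (p - 1)) = 1 by field_simp] at key
  simp only [ENNReal.rpow_one, ENNReal.tsum_geometric] at key
  have hterm : ∀ m, r ^ m * y m ^ (1 / p) = (r ^ m * y m) ^ (1 / p) * (r ^ m) ^ ((p - 1) / p) := by
    intro m
    rw [ENNReal.mul_rpow_of_nonneg _ _ (by positivity), mul_right_comm,
      ← ENNReal.rpow_add_of_nonneg _ _ (by positivity) (by positivity),
      show 1 / p + (p - 1) / p = 1 by field_simp; ring, ENNReal.rpow_one]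
  simp only [← hterm] at key
  refine (ENNReal.rpow_le_rpow key hp0.le).trans_eq ?_
  rw [ENNReal.mul_rpow_of_nonneg _ _ hp0.le, ← ENNReal.rpow_mul, ← ENNReal.rpow_mul,
    one_div_mul_cancel hp0.ne', div_mul_cancel₀ _ hp0.ne', ENNReal.rpow_one, mul_comm]

/-- The pointwise form of the weighted Hardy inequality. -/
lemma primitive_mul_average_rpow_le (hp : 1 < p) (hw : IsMuckenhoupt p w) {g : ℝ → ℝ≥0∞}
    (hg : Measurable g) {t : ℝ} (ht : 0 < t) :
    primitive w t⁻¹ * (ENNReal.ofReal t * ∫⁻ τ in Ioc 0 t⁻¹, g τ) ^ p ≤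
      apConst p w * (1 - halvingRate p (apConst p w) ^ ((p - 1) / p))⁻¹ ^ (p - 1) *
        ∑' m : ℕ, (halvingRate p (apConst p w) ^ ((p - 1) / p)) ^ m *
          ∫⁻ τ in Ioc (t⁻¹ * 2⁻¹ ^ (m + 1)) (t⁻¹ * 2⁻¹ ^ m), g τ ^ p * w τ := by
  have hp0 : 0 < p := by linarith
  set θ := halvingRate p (apConst p w)
  set r := θ ^ ((p - 1) / p) with hr
  have hs : 0 < t⁻¹ := inv_pos.2 ht
  set s := t⁻¹ with hst
  set S := dualPrimitive p w s
  set y : ℕ → ℝ≥0∞ := fun m => ∫⁻ τ in Ioc (s * 2⁻¹ ^ (m + 1)) (s * 2⁻¹ ^ m), g τ ^ p * w τ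
  have h1 : ∫⁻ τ in Ioc 0 s, g τ ≤ S ^ ((p - 1) / p) * ∑' m, r ^ m * y m ^ (1 / p) := by
    calc ∫⁻ τ in Ioc 0 s, g τ
        ≤ ∫⁻ τ in ⋃ m : ℕ, Ioc (s * 2⁻¹ ^ (m + 1)) (s * 2⁻¹ ^ m), g τ :=
          lintegral_mono_set (Ioc_subset_iUnion_Ioc_mul_pow hs)
      _ ≤ ∑' m : ℕ, ∫⁻ τ in Ioc (s * 2⁻¹ ^ (m + 1)) (s * 2⁻¹ ^ m), g τ :=
          lintegral_iUnion_le _ _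
      _ ≤ ∑' m : ℕ, S ^ ((p - 1) / p) * (r ^ m * y m ^ (1 / p)) := by
          refine ENNReal.tsum_le_tsum fun m => ?_
          refine (lintegral_le_rpow_mul_dualWeight hp hw hg _).trans ?_
          have h : (∫⁻ τ in Ioc (s * 2⁻¹ ^ (m + 1)) (s * 2⁻¹ ^ m), dualWeight p w τ) ≤
              θ ^ m * S :=
            (lintegral_mono_set (Ioc_subset_Ioc_left (by positivity))).trans
              (dualPrimitive_mul_pow_le hp hw hs m)
          calc _ ≤ y m ^ (1 / p) * (θ ^ m * S) ^ ((p - 1) / p) := by gcongr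
            _ = _ := by
              rw [ENNReal.mul_rpow_of_nonneg _ _ (by positivity), hr, ← ENNReal.rpow_natCast,
                ← ENNReal.rpow_natCast, ← ENNReal.rpow_mul, ← ENNReal.rpow_mul,
                mul_comm (m : ℝ)]
              ring
      _ = _ := ENNReal.tsum_mul_left
  -- A_p on (0, s], normalised by s t = 1.
  have h2 : primitive w s * (ENNReal.ofReal t ^ p * S ^ (p - 1)) ≤ apConst p w := by
    have hone : ENNReal.ofReal s ^ p * ENNReal.ofReal t ^ p = 1 := by
      rw [← ENNReal.mul_rpow_of_nonneg _ _ hp0.le, ← ENNReal.ofReal_mul hs.le, hst,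
        inv_mul_cancel₀ ht.ne']
      simp
    calc _ = primitive w s * S ^ (p - 1) * ENNReal.ofReal t ^ p := by ring
      _ ≤ apConst p w * ENNReal.ofReal s ^ p * ENNReal.ofReal t ^ p := by
          exact mul_le_mul_left (primitive_mul_dualPrimitive_le w hp hs) _
      _ = _ := by rw [mul_assoc, hone, mul_one]
  calc primitive w s * (ENNReal.ofReal t * ∫⁻ τ in Ioc 0 s, g τ) ^ p
      ≤ primitive w s * (ENNReal.ofReal t *
        (S ^ ((p - 1) / p) * ∑' m, r ^ m * y m ^ (1 / p))) ^ p := by gcongr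
    _ = primitive w s * (ENNReal.ofReal t ^ p * S ^ (p - 1)) *
        (∑' m, r ^ m * y m ^ (1 / p)) ^ p := by
        rw [ENNReal.mul_rpow_of_nonneg _ _ hp0.le, ENNReal.mul_rpow_of_nonneg _ _ hp0.le,
          ← ENNReal.rpow_mul, div_mul_cancel₀ _ hp0.ne']
        ring
    _ ≤ apConst p w * ((1 - r)⁻¹ ^ (p - 1) * ∑' m, r ^ m * y m) := by
        gcongr; exact tsum_pow_mul_rpow_le hp r y
    _ = _ := by rw [mul_assoc]

lemma measurable_indicator_Ioc_inv_mul_pow (m : ℕ) {h : ℝ → ℝ≥0∞} (hh : Measurable h) :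
    Measurable (Function.uncurry fun t τ : ℝ =>
      (Ioc (t⁻¹ * 2⁻¹ ^ (m + 1)) (t⁻¹ * 2⁻¹ ^ m)).indicator h τ / ENNReal.ofReal t) := by
  refine Measurable.div ?_ (by fun_prop)
  have hset : MeasurableSet {x : ℝ × ℝ | x.1⁻¹ * 2⁻¹ ^ (m + 1) < x.2 ∧ x.2 ≤ x.1⁻¹ * 2⁻¹ ^ m} := by
    refine MeasurableSet.inter (s₁ := {x : ℝ × ℝ | x.1⁻¹ * 2⁻¹ ^ (m + 1) < x.2})
      (s₂ := {x : ℝ × ℝ | x.2 ≤ x.1⁻¹ * 2⁻¹ ^ m}) ?_ ?_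
    · exact measurableSet_lt (by fun_prop) (by fun_prop)
    · exact measurableSet_le (by fun_prop) (by fun_prop)
  exact (hh.comp measurable_snd).indicator hset

/-- By Tonelli, a fixed τ is seen only by t between c = τ⁻¹ 2^{-(m+1)} and 2c. This interval has
length c and 1/t ≤ 1/c on it, so its dt/t mass is at most 1, uniformly in m. -/
lemma lintegral_lintegral_Ioc_inv_mul_pow_le {h : ℝ → ℝ≥0∞} (hh : Measurable h) (m : ℕ) :
    ∫⁻ t in Ioi (0 : ℝ), (∫⁻ τ in Ioc (t⁻¹ * 2⁻¹ ^ (m + 1)) (t⁻¹ * 2⁻¹ ^ m), h τ) /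
      ENNReal.ofReal t ≤ ∫⁻ τ in Ioi (0 : ℝ), h τ := by
  have hm := measurable_indicator_Ioc_inv_mul_pow m hh
  calc _ = ∫⁻ t in Ioi (0 : ℝ), ∫⁻ τ in Ioi (0 : ℝ),
        (Ioc (t⁻¹ * 2⁻¹ ^ (m + 1)) (t⁻¹ * 2⁻¹ ^ m)).indicator h τ / ENNReal.ofReal t := by
        refine setLIntegral_congr_fun measurableSet_Ioi fun t (ht : 0 < t) => ?_
        simp only [div_eq_mul_inv]
        rw [lintegral_mul_const _ (hh.indicator measurableSet_Ioc),
          setLIntegral_indicator measurableSet_Ioc, inter_eq_left.2]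
        exact fun τ hτ => lt_trans (by positivity) hτ.1
    _ = ∫⁻ τ in Ioi (0 : ℝ), ∫⁻ t in Ioi (0 : ℝ),
        (Ioc (t⁻¹ * 2⁻¹ ^ (m + 1)) (t⁻¹ * 2⁻¹ ^ m)).indicator h τ / ENNReal.ofReal t :=
        lintegral_lintegral_swap hm.aemeasurable
    _ ≤ _ := by
        refine setLIntegral_mono hh fun τ (hτ : 0 < τ) => ?_
        have hc : 0 < τ⁻¹ * 2⁻¹ ^ (m + 1) := by positivity
        calc _ ≤ ∫⁻ t in Ioi (0 : ℝ), (Ioc (τ⁻¹ * 2⁻¹ ^ (m + 1)) (τ⁻¹ * 2⁻¹ ^ m)).indicator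
              (fun _ => h τ / ENNReal.ofReal (τ⁻¹ * 2⁻¹ ^ (m + 1))) t := by
              refine setLIntegral_mono (measurable_const.indicator measurableSet_Ioc)
                fun t (ht : 0 < t) => ?_
              by_cases hmem : τ ∈ Ioc (t⁻¹ * 2⁻¹ ^ (m + 1)) (t⁻¹ * 2⁻¹ ^ m)
              · obtain ⟨h1, h2⟩ := hmem
                have h1' : τ⁻¹ * 2⁻¹ ^ (m + 1) < t := by
                  rw [inv_mul_lt_iff₀ ht] at h1
                  rw [inv_mul_lt_iff₀ hτ]; linarith
                have h2' : t ≤ τ⁻¹ * 2⁻¹ ^ m := by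
                  rw [le_inv_mul_iff₀ ht] at h2
                  rw [le_inv_mul_iff₀ hτ]; linarith
                rw [indicator_of_mem (mem_Ioc.2 ⟨h1, h2⟩), indicator_of_mem (mem_Ioc.2 ⟨h1', h2'⟩)]
                gcongr
              · rw [indicator_of_notMem hmem]
                simp
          _ ≤ ∫⁻ t in Ioc (τ⁻¹ * 2⁻¹ ^ (m + 1)) (τ⁻¹ * 2⁻¹ ^ m),
                h τ / ENNReal.ofReal (τ⁻¹ * 2⁻¹ ^ (m + 1)) := by
              rw [← lintegral_indicator measurableSet_Ioc]
              exact setLIntegral_le_lintegral _ _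
          _ = h τ := by
              rw [setLIntegral_const, Real.volume_Ioc,
                show τ⁻¹ * 2⁻¹ ^ m - τ⁻¹ * 2⁻¹ ^ (m + 1) = τ⁻¹ * 2⁻¹ ^ (m + 1) by ring,
                ENNReal.div_mul_cancel (by simpa using hc) ENNReal.ofReal_ne_top]

/-- The weighted Hardy inequality for measurable functions. -/
lemma lintegral_hardy_le_of_measurable (hp : 1 < p) (hw : IsMuckenhoupt p w) {g : ℝ → ℝ≥0∞}
    (hg : Measurable g) :
    ∫⁻ t in Ioi (0 : ℝ), primitive w t⁻¹ * (ENNReal.ofReal t * ∫⁻ τ in Ioc 0 t⁻¹, g τ) ^ p /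
      ENNReal.ofReal t ≤ hardyConst p (apConst p w) ^ p * ∫⁻ τ in Ioi (0 : ℝ), g τ ^ p * w τ := by
  have hp0 : 0 < p := by linarith
  have hp1 : 0 < p - 1 := by linarith
  set A := apConst p w
  set r := halvingRate p A ^ ((p - 1) / p) with hr
  have hgw : Measurable fun τ => g τ ^ p * (w τ : ℝ≥0∞) :=
    (hg.pow_const _).mul hw.measurable.coe_nnreal_ennreal
  have hmeas : ∀ m : ℕ, AEMeasurable (fun t : ℝ =>
      (∫⁻ τ in Ioc (t⁻¹ * 2⁻¹ ^ (m + 1)) (t⁻¹ * 2⁻¹ ^ m), g τ ^ p * w τ) / ENNReal.ofReal t)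
      (volume.restrict (Ioi 0)) := by
    intro m
    refine (Measurable.lintegral_prod_right (ν := volume)
      (measurable_indicator_Ioc_inv_mul_pow m hgw)).aemeasurable.congr (.of_forall fun t => ?_)
    simp only [div_eq_mul_inv]
    rw [lintegral_mul_const _ (hgw.indicator measurableSet_Ioc),
      lintegral_indicator measurableSet_Ioc]
  calc _ ≤ ∫⁻ t in Ioi (0 : ℝ), A * (1 - r)⁻¹ ^ (p - 1) * ∑' m : ℕ, r ^ m *
        ((∫⁻ τ in Ioc (t⁻¹ * 2⁻¹ ^ (m + 1)) (t⁻¹ * 2⁻¹ ^ m), g τ ^ p * w τ) /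
          ENNReal.ofReal t) := by
        refine lintegral_mono_ae ?_
        filter_upwards [ae_restrict_mem measurableSet_Ioi] with t ht
        refine (ENNReal.div_le_div_right (primitive_mul_average_rpow_le hp hw hg ht) _).trans_eq ?_
        simp only [div_eq_mul_inv _ (ENNReal.ofReal t), ← mul_assoc, ENNReal.tsum_mul_right]
        rfl
    _ = A * (1 - r)⁻¹ ^ (p - 1) * ∑' m : ℕ, r ^ m * ∫⁻ t in Ioi (0 : ℝ),
        (∫⁻ τ in Ioc (t⁻¹ * 2⁻¹ ^ (m + 1)) (t⁻¹ * 2⁻¹ ^ m), g τ ^ p * w τ) /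
          ENNReal.ofReal t := by
        rw [lintegral_const_mul'' _ (AEMeasurable.tsum fun m => (hmeas m).const_mul _),
          lintegral_tsum fun m => (hmeas m).const_mul _]
        simp_rw [lintegral_const_mul'' _ (hmeas _)]
    _ ≤ A * (1 - r)⁻¹ ^ (p - 1) * ∑' m : ℕ, r ^ m * ∫⁻ τ in Ioi (0 : ℝ), g τ ^ p * w τ := by
        refine mul_le_mul_right (ENNReal.tsum_le_tsum fun m => mul_le_mul_right ?_ _) _
        exact lintegral_lintegral_Ioc_inv_mul_pow_le hgw m
    _ = _ := by
        -- The series contributes one more factor (1 - r)⁻¹, which gives the power p in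
        -- `hardyConst`.
        rw [ENNReal.tsum_mul_right, ENNReal.tsum_geometric, hardyConst,
          ENNReal.mul_rpow_of_nonneg _ _ hp0.le, ← ENNReal.rpow_mul,
          one_div_mul_cancel hp0.ne', ENNReal.rpow_one, ← hr]
        have : (1 - r)⁻¹ ^ p = (1 - r)⁻¹ ^ (p - 1) * (1 - r)⁻¹ := by
          conv_rhs => rw [← ENNReal.rpow_one (1 - r)⁻¹, ← ENNReal.rpow_mul]
          rw [one_mul, ← ENNReal.rpow_add_of_nonneg _ _ hp1.le zero_le_one, sub_add_cancel]
        rw [this]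
        ring

/-- Transfers measurability and a.e. equality from w dt to Lebesgue measure, where the unweighted
averages live. -/
lemma restrict_Ioi_absolutelyContinuous_halfLineMeasure (hw : IsMuckenhoupt p w) :
    volume.restrict (Ioi 0) ≪ halfLineMeasure w := by
  refine withDensity_absolutelyContinuous' hw.measurable.coe_nnreal_ennreal.aemeasurable ?_
  filter_upwards [ae_restrict_of_ae hw.ae_pos] with t ht
  simpa using ht.ne'

/-- The weighted Hardy inequality. -/
lemma rpow_lintegral_hardy_le (hp : 1 < p) (hw : IsMuckenhoupt p w) {g : ℝ → ℝ≥0∞}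
    (hg : AEMeasurable g (halfLineMeasure w)) :
    (∫⁻ t in Ioi (0 : ℝ), (primitive w t⁻¹ ^ (1 / p) *
      (ENNReal.ofReal t * ∫⁻ τ in Ioc 0 t⁻¹, g τ)) ^ p / ENNReal.ofReal t) ^ (1 / p) ≤
      hardyConst p (apConst p w) * (∫⁻ τ, g τ ^ p ∂halfLineMeasure w) ^ (1 / p) := by
  have hp0 : 0 < p := by linarith
  have hwm : Measurable fun t => (w t : ℝ≥0∞) := hw.measurable.coe_nnreal_ennreal
  have heq := hg.ae_eq_mk
  have hae := (restrict_Ioi_absolutelyContinuous_halfLineMeasure hw).ae_le heq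
  have hnorm : ∫⁻ τ, g τ ^ p ∂halfLineMeasure w = ∫⁻ τ in Ioi (0 : ℝ), hg.mk _ τ ^ p * w τ := by
    have hpow : ∫⁻ τ, g τ ^ p ∂halfLineMeasure w = ∫⁻ τ, hg.mk _ τ ^ p ∂halfLineMeasure w :=
      lintegral_congr_ae (heq.fun_comp (· ^ p))
    refine hpow.trans ((lintegral_withDensity_eq_lintegral_mul _ hwm
      (hg.measurable_mk.pow_const _)).trans ?_)
    exact lintegral_congr fun τ => mul_comm _ _
  have h := ENNReal.rpow_le_rpow (lintegral_hardy_le_of_measurable hp hw hg.measurable_mk)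
    (z := 1 / p) (by positivity)
  rw [ENNReal.mul_rpow_of_nonneg _ _ (by positivity), ← ENNReal.rpow_mul,
    mul_one_div_cancel hp0.ne', ENNReal.rpow_one, ← hnorm] at h
  refine le_trans (le_of_eq ?_) h
  congr 1
  refine lintegral_congr fun t => ?_
  rw [ENNReal.mul_rpow_of_nonneg _ _ hp0.le, ← ENNReal.rpow_mul, one_div_mul_cancel hp0.ne',
    ENNReal.rpow_one, lintegral_congr_ae (ae_restrict_of_ae_restrict_of_subset
      Ioc_subset_Ioi_self hae)]

/-! ### The K-functional of the initial value -/

namespace InterpolationCouple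

variable {X₀ X₁ Z : Type*}
  [NormedAddCommGroup X₀] [NormedSpace ℝ X₀] [NormedAddCommGroup X₁] [NormedSpace ℝ X₁]
  [AddCommGroup Z] [Module ℝ Z] [TopologicalSpace Z]

lemma K_le (E : InterpolationCouple X₀ X₁ Z) {t : ℝ} (ht : 0 < t) {a : Z} {x₀ : X₀} {x₁ : X₁}
    (h : a = E.ι₀ x₀ + E.ι₁ x₁) : E.K t a ≤ ‖x₀‖ₑ + ENNReal.ofReal t * ‖x₁‖ₑ := by
  refine (iInf₂_le_of_le x₀ x₁ (iInf_le _ h)).trans_eq ?_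
  rw [ENNReal.ofReal_add (norm_nonneg _) (by positivity), ENNReal.ofReal_mul ht.le,
    ofReal_norm, ofReal_norm]

/-- The `K`-functional of an initial value is controlled by the averages of the function and of
its derivative. -/
lemma K_le_average (E : InterpolationCouple X₀ X₁ Z) {u : ℝ → X₀} {f : ℝ → X₁}
    {u₀ : Z} (hu : AEMeasurable (fun t => ‖u t‖ₑ) (volume.restrict (Ioi 0)))
    (h : ∀ᵐ t ∂(volume.restrict (Ioi (0 : ℝ))), E.ι₀ (u t) = u₀ + E.ι₁ (∫ s in (0 : ℝ)..t, f s))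
    {t : ℝ} (ht : 0 < t) :
    E.K t u₀ ≤ ENNReal.ofReal t * ∫⁻ τ in Ioc 0 t⁻¹, (‖u τ‖ₑ + ‖f τ‖ₑ) := by
  have hone : ENNReal.ofReal t * ENNReal.ofReal t⁻¹ = 1 := by
    rw [← ENNReal.ofReal_mul ht.le, mul_inv_cancel₀ ht.ne', ENNReal.ofReal_one]
  have hpt : ∀ᵐ τ ∂(volume.restrict (Ioc 0 t⁻¹)),
      E.K t u₀ ≤ ‖u τ‖ₑ + ENNReal.ofReal t * ∫⁻ τ in Ioc 0 t⁻¹, ‖f τ‖ₑ := by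
    filter_upwards [ae_restrict_of_ae_restrict_of_subset Ioc_subset_Ioi_self h,
      ae_restrict_mem measurableSet_Ioc] with τ hτ hmem
    refine (E.K_le ht (x₀ := u τ) (x₁ := -∫ s in (0 : ℝ)..τ, f s) ?_).trans ?_
    · rw [hτ, map_neg]; abel
    · rw [enorm_neg, intervalIntegral.integral_of_le hmem.1.le]
      gcongr
      -- This bound also holds when the Bochner integral takes its default value 0, so integrability
      -- of f need not be checked.
      exact (enorm_integral_le_lintegral_enorm _).trans
        (lintegral_mono_set (Ioc_subset_Ioc_right hmem.2))
  -- The left side and the f-term are constant in τ; integrating over (0, 1/t] and multiplying by t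
  -- averages only ‖u‖.
  have hint := lintegral_mono_ae hpt
  rw [lintegral_const, lintegral_add_right' _ aemeasurable_const, lintegral_const] at hint
  simp only [Measure.restrict_apply_univ, Real.volume_Ioc, sub_zero] at hint
  calc E.K t u₀ = ENNReal.ofReal t * (E.K t u₀ * ENNReal.ofReal t⁻¹) := by
        rw [mul_left_comm, hone, mul_one]
    _ ≤ _ := mul_le_mul_right hint _
    _ = _ := by
        rw [mul_right_comm, hone, one_mul,
          lintegral_add_left' (hu.mono_measure (Measure.restrict_mono_set _ Ioc_subset_Ioi_self))]

end InterpolationCouple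

lemma eLpNorm_ofReal_eq {X : Type*} [NormedAddCommGroup X] (hp : 1 < p) (μ : Measure ℝ)
    (v : ℝ → X) :
    eLpNorm v (ENNReal.ofReal p) μ = (∫⁻ τ, ‖v τ‖ₑ ^ p ∂μ) ^ (1 / p) := by
  have hp0 : 0 < p := by linarith
  rw [eLpNorm_eq_lintegral_rpow_enorm_toReal (by simpa using hp0) ENNReal.ofReal_ne_top,
    ENNReal.toReal_ofReal hp0.le]

end WeightedTrace

end

theorem theorem1p1 :
    ∃ C : ℝ → ℝ≥0∞ → ℝ≥0,
      ∀ (p : ℝ), 1 < p →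
      ∀ (w : ℝ → ℝ≥0), WeightedTrace.IsMuckenhoupt p w →
      ∀ (X₀ X₁ Z : Type*)
        [NormedAddCommGroup X₀] [NormedSpace ℝ X₀] [CompleteSpace X₀]
        [NormedAddCommGroup X₁] [NormedSpace ℝ X₁] [CompleteSpace X₁]
        [AddCommGroup Z] [Module ℝ Z] [TopologicalSpace Z]
        [IsTopologicalAddGroup Z] [ContinuousSMul ℝ Z] [T2Space Z]
        (E : WeightedTrace.InterpolationCouple X₀ X₁ Z)
        (u : ℝ → X₀) (f : ℝ → X₁) (u₀ : Z),
        MemLp u (ENNReal.ofReal p) (WeightedTrace.halfLineMeasure w) →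
        MemLp f (ENNReal.ofReal p) (WeightedTrace.halfLineMeasure w) →
        u₀ ∈ E.sum →
        (∀ᵐ t ∂(volume.restrict (Ioi (0 : ℝ))),
          E.ι₀ (u t) = u₀ + E.ι₁ (∫ s in (0 : ℝ)..t, f s)) →
        u₀ ∈ E.interpSpace (fun t => WeightedTrace.primitive w t ^ (1 / p)) p ∧
        E.interpNorm (fun t => WeightedTrace.primitive w t ^ (1 / p)) p u₀ ≤
          C p (WeightedTrace.apConst p w) *
            (eLpNorm u (ENNReal.ofReal p) (WeightedTrace.halfLineMeasure w) +
              eLpNorm f (ENNReal.ofReal p) (WeightedTrace.halfLineMeasure w)) := by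
  -- Truncation to a finite value loses nothing when p > 1 and A < ∞.
  refine ⟨fun p A => (WeightedTrace.hardyConst p A).toNNReal, ?_⟩
  intro p hp w hw X₀ X₁ Z _ _ _ _ _ _ _ _ _ _ _ _ E u f u₀ hu hf hu₀ h
  have hC : ((WeightedTrace.hardyConst p (WeightedTrace.apConst p w)).toNNReal : ℝ≥0∞) =
      WeightedTrace.hardyConst p (WeightedTrace.apConst p w) :=
    ENNReal.coe_toNNReal (WeightedTrace.hardyConst_lt_top hp hw.apConst_lt_top).ne
  suffices hle : E.interpNorm (fun t => WeightedTrace.primitive w t ^ (1 / p)) p u₀ ≤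
      (WeightedTrace.hardyConst p (WeightedTrace.apConst p w)).toNNReal *
        (eLpNorm u (ENNReal.ofReal p) (WeightedTrace.halfLineMeasure w) +
          eLpNorm f (ENNReal.ofReal p) (WeightedTrace.halfLineMeasure w)) from
    ⟨⟨hu₀, hle.trans_lt (ENNReal.mul_lt_top ENNReal.coe_lt_top
      (ENNReal.add_lt_top.2 ⟨hu.2, hf.2⟩))⟩, hle⟩
  have hac := WeightedTrace.restrict_Ioi_absolutelyContinuous_halfLineMeasure hw
  rw [hC, WeightedTrace.eLpNorm_ofReal_eq hp _ u,
    WeightedTrace.eLpNorm_ofReal_eq hp _ f]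
  -- Hardy for ‖u‖ + ‖f‖, followed by Minkowski in L_p(w).
  refine le_trans ?_ ((WeightedTrace.rpow_lintegral_hardy_le hp hw
    (hu.1.enorm.add hf.1.enorm)).trans (mul_le_mul_right
      (ENNReal.lintegral_Lp_add_le hu.1.enorm hf.1.enorm hp.le) _))
  refine ENNReal.rpow_le_rpow (lintegral_mono_ae ?_) (by positivity)
  filter_upwards [ae_restrict_mem measurableSet_Ioi] with t ht
  gcongr
  exact E.K_le_average (hu.1.mono_ac hac).enorm h ht
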